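/- Let $\beta>0$. For an integer $n\ge 1$ and a real $c\ge 1$ (in applications $c=m/n$ for an $n\times m$ Gaussian data matrix $\mathcal X$, and $\lambda_1,\dots,\lambda_n$ are the eigenvalues of $\frac1n\mathcal X\mathcal X^\dagger$) let $(\lambda_1,\dots,\lambda_n)$ be distributed on $(0,\infty)^n$ with density $$\frac1{\mathcal Z_n}e^{-\beta E[\lambda]},\qquad E[\lambda]=-\frac12\sum_{i\ne j}\ln|\lambda_i-\lambda_j|+n\sum_{k}\Big(\frac{\lambda_k}{2}-\alpha\ln\lambda_k\Big),\qquad \alpha=\frac{c-1}{2}+\frac1{2n}-\frac1{\beta n},$$ where $\mathcal Z_n=\int_{(0,\infty)^n}e^{-\beta E[\lambda]}\,d\lambda\in(0,\infty)$ (so this is a probability law), and put $$T=\frac1n\sum_{i=1}^n\lambda_i,\qquad H=\frac1n\sum_{i=1}^n\ln\lambda_i .$$ Then, for every $n\ge1$, as $c\to\infty$, $$\sqrt{\frac{\beta n^2}{2c}}\,(T-c)\to\mathcal N(0,1)\qquad\text{and}\qquad\sqrt{\frac{\beta c n^2}{2}}\,(H-\ln c)\to\mathcal N(0,1)$$ in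 distribution. Moreover $n$ may vary with $c$ (in particular $n\to\infty$): for sequences of integers $n_k\ge1$ and reals $c_k\ge1$ with $c_k\to\infty$, the convergence of $T$ holds along $(n_k,c_k)$, and the convergence of $H$ holds along $(n_k,c_k)$ if $c_k$ is large compared with $n_k^2$, that is, if $n_k^2/c_k\to0$. -/

import Mathlib

open MeasureTheory ProbabilityTheory Filter Topology

noncomputable section

namespace WishartEnsemble

/-- The exponent `α = (c - 1) / 2 + 1 / (2 n) - 1 / (β n)` of the external potential. -/
def alpha (β : ℝ) (n : ℕ) (c : ℝ) : ℝ :=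
  (c - 1) / 2 + 1 / (2 * (n : ℝ)) - 1 / (β * (n : ℝ))

/-- The external potential `V(x) = x / 2 - α ln x`, for `x > 0`. -/
def potential (β : ℝ) (n : ℕ) (c : ℝ) (x : ℝ) : ℝ :=
  x / 2 - alpha β n c * Real.log x

/-- The energy
`E[x] = - (1 / 2) ∑_{i ≠ j} ln |x i - x j| + n ∑_k V(x k)`
of a configuration of distinct positive points. -/
def energy (β : ℝ) (n : ℕ) (c : ℝ) (x : Fin n → ℝ) : ℝ :=
  -(1 / 2) * (∑ i, ∑ j ∈ Finset.univ.erase i, Real.log |x i - x j|)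
    + (n : ℝ) * ∑ k, potential β n c (x k)

/-- The configurations of finite energy: distinct positive points. -/
def configurations (n : ℕ) : Set (Fin n → ℝ) :=
  {x | (∀ i, 0 < x i) ∧ Function.Injective x}

/-- The Boltzmann weight `exp (-β E[x])`, which is zero where the energy is infinite. -/
def boltzmannWeight (β : ℝ) (n : ℕ) (c : ℝ) : (Fin n → ℝ) → ℝ :=
  (configurations n).indicator fun x ↦ Real.exp (-β * energy β n c x)

/-- The normalization constant `𝒵 = ∫ exp (-β E[x]) dx`. -/
def partitionFunction (β : ℝ) (n : ℕ) (c : ℝ) : ENNReal :=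
  ∫⁻ x : Fin n → ℝ, ENNReal.ofReal (boltzmannWeight β n c x)

/-- The joint law of the eigenvalues of the Wishart `β`-ensemble of size `n` and
rectangularity `c`: the measure on `ℝⁿ` with density `exp (-β E[x]) / 𝒵`. -/
def eigenvalueLaw (β : ℝ) (n : ℕ) (c : ℝ) : Measure (Fin n → ℝ) :=
  (partitionFunction β n c)⁻¹ •
    (volume : Measure (Fin n → ℝ)).withDensity fun x ↦ ENNReal.ofReal (boltzmannWeight β n c x)

/-- The scaled trace `T = (1 / n) ∑ x i`. -/
def scaledTrace {n : ℕ} (x : Fin n → ℝ) : ℝ :=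
  (1 / (n : ℝ)) * ∑ i, x i

/-- The scaled log-determinant `H = (1 / n) ∑ ln (x i)`. -/
def scaledLogDet {n : ℕ} (x : Fin n → ℝ) : ℝ :=
  (1 / (n : ℝ)) * ∑ i, Real.log (x i)

/-- The rescaled trace `√(β n² / (2 c)) (T - c)`. -/
def normalizedTrace (β : ℝ) (n : ℕ) (c : ℝ) (x : Fin n → ℝ) : ℝ :=
  √(β * (n : ℝ) ^ 2 / (2 * c)) * (scaledTrace x - c)

/-- The rescaled log-determinant `√(β c n² / 2) (H - ln c)`. -/
def normalizedLogDet (β : ℝ) (n : ℕ) (c : ℝ) (x : Fin n → ℝ) : ℝ :=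
  √(β * c * (n : ℝ) ^ 2 / 2) * (scaledLogDet x - Real.log c)

end WishartEnsemble

end

/-! The Boltzmann weight is a Laguerre weight, homogeneous up to its factor `exp (-b ∑ x k)`. An
exponential tilt of `∑ x k` only changes `b`, and scaling then evaluates its Laplace transform
exactly. So `∑ x k` has the gamma law of shape `K = β c n² / 2` and rate `n β / 2`, and the
normalized trace is a standardized gamma variable, whose characteristic function is explicit
(`charFun_map_normalizedTrace`). Only `K → ∞` is needed for the Gaussian limit, which is why `n` may
vary freely with `c`.

The log-determinant is compared with the trace in `L¹`. The difference of the two normalized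
statistics is `√K / n` times the sum of `y - 1 - ln y` over `y = x k / c`, and `0 ≤ y - 1 - ln y ≤ y
+ 1 / y - 2`. Since the normalized trace has mean zero, only the mean of `∑ 1 / x k` remains to be
estimated, and translation invariance of Lebesgue measure bounds it (`integrable_mul_sum_inv`). The
difference is `O(√(n² / c))` in `L¹`, so both statistics have the same limit when `n² / c → 0`. -/

noncomputable section

namespace WishartEnsemble

/-! ### The Laguerre weight: integrability and scaling -/

/-- The Laguerre weight
`∏_{i<j} |x i - x j| ^ β * ∏ (x k) ^ γ * exp (-b ∑ x k)` on distinct positive points. -/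
def laguerreWeight (β γ b : ℝ) {n : ℕ} : (Fin n → ℝ) → ℝ :=
  (configurations n).indicator fun x ↦ Real.exp
    (β / 2 * (∑ i, ∑ j ∈ Finset.univ.erase i, Real.log |x i - x j|)
      + γ * ∑ k, Real.log (x k) - b * ∑ k, x k)

lemma boltzmannWeight_eq_laguerreWeight (β : ℝ) (n : ℕ) (c : ℝ) :
    boltzmannWeight β n c = laguerreWeight β (β * n * alpha β n c) (n * β / 2) := by
  unfold boltzmannWeight laguerreWeight
  congr 1
  funext x
  congr 1
  simp only [energy, potential, Finset.sum_sub_distrib, ← Finset.sum_div, ← Finset.mul_sum]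
  ring

lemma measurableSet_configurations (n : ℕ) : MeasurableSet (configurations n) := by
  have : configurations n = (⋂ i, {x : Fin n → ℝ | 0 < x i}) ∩
      ⋂ i, ⋂ j, {x : Fin n → ℝ | x i = x j → i = j} := by
    ext x
    simp [configurations, Function.Injective]
  rw [this]
  refine (MeasurableSet.iInter fun i ↦ measurableSet_lt measurable_const
    (measurable_pi_apply i)).inter (MeasurableSet.iInter fun i ↦ MeasurableSet.iInter fun j ↦ ?_)
  by_cases h : i = j
  · simp [h]
  · simp only [h, imp_false]
    exact (measurableSet_eq_fun (measurable_pi_apply i) (measurable_pi_apply j)).compl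

lemma measurable_laguerreWeight (β γ b : ℝ) (n : ℕ) :
    Measurable (laguerreWeight β γ b (n := n)) := by
  refine Measurable.indicator ?_ (measurableSet_configurations n)
  fun_prop

lemma laguerreWeight_nonneg (β γ b : ℝ) {n : ℕ} (x : Fin n → ℝ) :
    0 ≤ laguerreWeight β γ b x :=
  Set.indicator_nonneg (fun _ _ ↦ (Real.exp_pos _).le) x

/-- Apply `ln u ≤ u - 1` at `u = ε |x - y|`. The slope `ε` is free, so the interaction can be
absorbed into part of the exponential decay. -/
lemma log_abs_sub_le {ε : ℝ} (hε : 0 < ε) {x y : ℝ} (hx : 0 < x) (hy : 0 < y) :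
    Real.log |x - y| ≤ ε * (x + y) + |Real.log ε| := by
  rcases eq_or_ne x y with rfl | h
  · simp only [sub_self, abs_zero, Real.log_zero]
    positivity
  · have h0 : 0 < |x - y| := abs_pos.2 (sub_ne_zero.2 h)
    have h1 := Real.log_le_sub_one_of_pos (mul_pos hε h0)
    rw [Real.log_mul hε.ne' h0.ne'] at h1
    have h2 : |x - y| ≤ x + y := by
      rw [abs_le]
      constructor <;> linarith
    have h3 := mul_le_mul_of_nonneg_left h2 hε.le
    linarith [neg_abs_le (Real.log ε)]

lemma sum_log_abs_sub_le {ε : ℝ} (hε : 0 < ε) {n : ℕ} {x : Fin n → ℝ} (hx : ∀ i, 0 < x i) :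
    ∑ i, ∑ j ∈ Finset.univ.erase i, Real.log |x i - x j|
      ≤ 2 * n * ε * (∑ k, x k) + n ^ 2 * |Real.log ε| := by
  calc _ ≤ ∑ i, ∑ j, (ε * (x i + x j) + |Real.log ε|) := by
        refine Finset.sum_le_sum fun i _ ↦ ?_
        refine (Finset.sum_le_sum fun j _ ↦ log_abs_sub_le hε (hx i) (hx j)).trans ?_
        refine Finset.sum_le_sum_of_subset_of_nonneg (Finset.erase_subset _ _) fun j _ _ ↦ ?_
        have := hx i
        have := hx j
        positivity
    _ = _ := by
        simp only [Finset.sum_add_distrib, ← Finset.mul_sum, Finset.sum_const, Finset.card_univ,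
          Fintype.card_fin, nsmul_eq_mul]
        ring

lemma integrable_indicator_rpow_mul_exp {γ b : ℝ} (hγ : -1 < γ) (hb : 0 < b) :
    Integrable ((Set.Ioi (0 : ℝ)).indicator fun x ↦ x ^ γ * Real.exp (-b * x)) := by
  rw [integrable_indicator_iff measurableSet_Ioi]
  have := integrableOn_rpow_mul_exp_neg_mul_rpow (p := 1) hγ one_pos hb
  simpa using this

/-- With `ε` small the interaction costs at most half the decay rate, so a product of
one-dimensional gamma densities of rate `b / 2` dominates the weight. -/
lemma integrable_laguerreWeight {β γ b : ℝ} (hβ : 0 < β) (hγ : -1 < γ) (hb : 0 < b) (n : ℕ) :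
    Integrable (laguerreWeight β γ b (n := n)) := by
  obtain ⟨ε, hε, hεb⟩ : ∃ ε : ℝ, 0 < ε ∧ β * n * ε ≤ b / 2 := by
    -- The `n + 1` keeps the denominator nonzero when `n = 0`.
    refine ⟨b / (2 * (β * (n + 1))), by positivity, ?_⟩
    rw [mul_div_assoc', div_le_div_iff₀ (by positivity) (by positivity)]
    nlinarith [mul_pos hβ hb]
  have hg := (integrable_indicator_rpow_mul_exp hγ (half_pos hb))
  have hG := (Integrable.fintype_prod (ι := Fin n) (fun _ ↦ hg)).const_mul
    (Real.exp (β / 2 * (n ^ 2 * |Real.log ε|)))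
  refine hG.mono' (measurable_laguerreWeight β γ b n).aestronglyMeasurable (.of_forall fun x ↦ ?_)
  rw [Real.norm_of_nonneg (laguerreWeight_nonneg _ _ _ _)]
  unfold laguerreWeight
  by_cases hx : x ∈ configurations n
  · rw [Set.indicator_of_mem hx]
    have hpos := hx.1
    have hprod : ∏ i, (Set.Ioi (0 : ℝ)).indicator
        (fun x ↦ x ^ γ * Real.exp (-(b / 2) * x)) (x i)
        = Real.exp (γ * ∑ k, Real.log (x k) - b / 2 * ∑ k, x k) := by
      rw [Finset.mul_sum, Finset.mul_sum, ← Finset.sum_sub_distrib, Real.exp_sum]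
      refine Finset.prod_congr rfl fun i _ ↦ ?_
      rw [Set.indicator_of_mem (Set.mem_Ioi.2 (hpos i)), Real.rpow_def_of_pos (hpos i), ← Real.exp_add]
      ring_nf
    rw [hprod, ← Real.exp_add, Real.exp_le_exp]
    have h1 := mul_le_mul_of_nonneg_left (sum_log_abs_sub_le hε hpos) (half_pos hβ).le
    have h2 : β * n * ε * ∑ k, x k ≤ b / 2 * ∑ k, x k :=
      mul_le_mul_of_nonneg_right hεb (Finset.sum_nonneg fun i _ ↦ (hpos i).le)
    linarith
  · rw [Set.indicator_of_notMem hx]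
    refine mul_nonneg (Real.exp_pos _).le (Finset.prod_nonneg fun i _ ↦ ?_)
    exact Set.indicator_nonneg (fun y (hy : 0 < y) ↦ by positivity) _

lemma volume_configurations_pos (n : ℕ) : 0 < volume (configurations n) := by
  have hsub : Set.univ.pi (fun i : Fin n ↦ Set.Ioo (i : ℝ) (i + 1)) ⊆ configurations n := by
    intro x hx
    simp only [Set.mem_univ_pi, Set.mem_Ioo] at hx
    refine ⟨fun i ↦ (Nat.cast_nonneg _).trans_lt (hx i).1, fun i j hij ↦ ?_⟩
    have h1 : ((i : ℕ) : ℝ) < ((j : ℕ) + 1 : ℕ) := by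
      push_cast; linarith [(hx i).1, (hx j).2]
    have h2 : ((j : ℕ) : ℝ) < ((i : ℕ) + 1 : ℕ) := by
      push_cast; linarith [(hx i).2, (hx j).1]
    rw [Nat.cast_lt] at h1 h2
    ext
    omega
  refine lt_of_lt_of_le ?_ (measure_mono hsub)
  rw [volume_pi_pi]
  simp

lemma integral_laguerreWeight_pos {β γ b : ℝ} (hβ : 0 < β) (hγ : -1 < γ) (hb : 0 < b) (n : ℕ) :
    0 < ∫ x : Fin n → ℝ, laguerreWeight β γ b x := by
  rw [integral_pos_iff_support_of_nonneg (laguerreWeight_nonneg β γ b)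
    (integrable_laguerreWeight hβ hγ hb n)]
  convert volume_configurations_pos n
  ext x
  simp [laguerreWeight, Function.mem_support, (Real.exp_pos _).ne']

lemma smul_mem_configurations_iff {n : ℕ} {r : ℝ} (hr : 0 < r) (x : Fin n → ℝ) :
    r • x ∈ configurations n ↔ x ∈ configurations n := by
  simp [configurations, Function.Injective, hr, hr.ne']

lemma laguerreWeight_smul (β γ b : ℝ) {n : ℕ} {r : ℝ} (hr : 0 < r) (x : Fin n → ℝ) :
    laguerreWeight β γ b (r • x)
      = r ^ (n * γ + β / 2 * (n * (n - 1))) * laguerreWeight β γ (b * r) x := by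
  unfold laguerreWeight
  by_cases hx : x ∈ configurations n
  · rw [Set.indicator_of_mem hx, Set.indicator_of_mem ((smul_mem_configurations_iff hr x).2 hx),
      Real.rpow_def_of_pos hr, ← Real.exp_add]
    congr 1
    have h1 : ∑ i, ∑ j ∈ Finset.univ.erase i, Real.log |(r • x) i - (r • x) j|
        = (n * (n - 1)) * Real.log r
          + ∑ i, ∑ j ∈ Finset.univ.erase i, Real.log |x i - x j| := by
      have : ∀ i, ∑ j ∈ Finset.univ.erase i, Real.log |(r • x) i - (r • x) j|
          = (n - 1) * Real.log r + ∑ j ∈ Finset.univ.erase i, Real.log |x i - x j| := by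
        intro i
        have hn : 1 ≤ n := i.pos
        rw [show ((n : ℝ) - 1) * Real.log r = ∑ j ∈ Finset.univ.erase i, Real.log r by
          simp [Finset.card_erase_of_mem, Nat.cast_sub hn], ← Finset.sum_add_distrib]
        refine Finset.sum_congr rfl fun j hj ↦ ?_
        have hij : x i - x j ≠ 0 :=
          sub_ne_zero.2 fun h ↦ (Finset.ne_of_mem_erase hj) (hx.2 h).symm
        rw [Pi.smul_apply, Pi.smul_apply, smul_eq_mul, smul_eq_mul, ← mul_sub, abs_mul,
          abs_of_pos hr, Real.log_mul hr.ne' (abs_pos.2 hij).ne']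
      simp only [this, Finset.sum_add_distrib, Finset.sum_const, Finset.card_univ,
        Fintype.card_fin, nsmul_eq_mul]
      ring
    have h2 : ∑ k, Real.log ((r • x) k) = n * Real.log r + ∑ k, Real.log (x k) := by
      simp [Real.log_mul hr.ne' (hx.1 _).ne', Finset.sum_add_distrib]
    rw [h1, h2]
    simp only [Pi.smul_apply, smul_eq_mul, ← Finset.mul_sum]
    ring
  · rw [Set.indicator_of_notMem hx,
      Set.indicator_of_notMem (mt (smul_mem_configurations_iff hr x).1 hx), mul_zero]

/-- Substitute `r • x` for `x`. The exponent collects `n γ` from the powers, `β / 2` for each of the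
`n (n - 1)` ordered pairs, and `n` from the Jacobian. -/
lemma integral_laguerreWeight_mul (β γ b : ℝ) (n : ℕ) {r : ℝ} (hr : 0 < r) :
    ∫ x : Fin n → ℝ, laguerreWeight β γ (b * r) x
      = r ^ (-(n * (γ + 1) + β / 2 * (n * (n - 1))))
        * ∫ x : Fin n → ℝ, laguerreWeight β γ b x := by
  have h := Measure.integral_comp_smul volume (laguerreWeight β γ b (n := n)) r
  simp only [laguerreWeight_smul β γ b hr, integral_const_mul] at h
  rw [Module.finrank_fin_fun, abs_of_pos (by positivity), smul_eq_mul, ← Real.rpow_natCast,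
    ← Real.rpow_neg hr.le] at h
  have h0 := Real.rpow_pos_of_pos hr (n * γ + β / 2 * (n * (n - 1)))
  rw [← mul_right_inj' h0.ne', h, ← mul_assoc, ← Real.rpow_add hr]
  ring_nf

/-! ### The mean of the inverse points, by translation -/

/-- A diagonal shift leaves the interaction unchanged and costs `exp (-n b t)`. The gain `((x k + t)
/ x k) ^ γ` is bounded below through `ln u ≤ u - 1` and `1 + s ≤ exp s`. Keeping `x k + t` in the
inverse makes the bound integrable without prior knowledge about `1 / x k`. -/
lemma mul_one_add_sum_le_laguerreWeight_add {β γ b : ℝ} (hγ : 0 ≤ γ) {n : ℕ} {t : ℝ} (ht : 0 < t)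
    (x : Fin n → ℝ) :
    Real.exp (-(n * b * t)) * (laguerreWeight β γ b x * (1 + γ * t * ∑ k, (x k + t)⁻¹))
      ≤ laguerreWeight β γ b (x + fun _ ↦ t) := by
  by_cases hx : x ∈ configurations n
  · have hx' : (x + fun _ ↦ t) ∈ configurations n :=
      ⟨fun i ↦ add_pos (hx.1 i) ht, fun i j h ↦ hx.2 (by simpa using h)⟩
    unfold laguerreWeight
    rw [Set.indicator_of_mem hx, Set.indicator_of_mem hx']
    have h1 : ∑ k, Real.log (x k) + t * ∑ k, (x k + t)⁻¹ ≤ ∑ k, Real.log (x k + t) := by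
      rw [Finset.mul_sum, ← Finset.sum_add_distrib]
      refine Finset.sum_le_sum fun k _ ↦ ?_
      have hk := hx.1 k
      have h2 := Real.log_le_sub_one_of_pos (div_pos hk (add_pos hk ht))
      rw [Real.log_div hk.ne' (add_pos hk ht).ne'] at h2
      have h3 : x k / (x k + t) - 1 = - (t * (x k + t)⁻¹) := by
        field_simp
        ring
      linarith
    have h2 := Real.add_one_le_exp (γ * (t * ∑ k, (x k + t)⁻¹))
    rw [show 1 + γ * t * ∑ k, (x k + t)⁻¹ = γ * (t * ∑ k, (x k + t)⁻¹) + 1 by ring]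
    refine (mul_le_mul_of_nonneg_left (mul_le_mul_of_nonneg_left h2 (Real.exp_pos _).le)
      (Real.exp_pos _).le).trans ?_
    rw [← Real.exp_add, ← Real.exp_add, Real.exp_le_exp]
    have h3 := mul_le_mul_of_nonneg_left h1 hγ
    simp only [Pi.add_apply, add_sub_add_right_eq_sub, Finset.sum_add_distrib, Finset.sum_const,
      Finset.card_univ, Fintype.card_fin, nsmul_eq_mul]
    linarith
  · have : laguerreWeight β γ b x = 0 := Set.indicator_of_notMem hx _
    simpa [this] using laguerreWeight_nonneg _ _ _ _

lemma integrable_mul_sum_inv_add {β γ b : ℝ} (hβ : 0 < β) (hγ : 0 < γ) (hb : 0 < b) {n : ℕ}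
    {t : ℝ} (ht : 0 < t) :
    Integrable (fun x : Fin n → ℝ ↦ laguerreWeight β γ b x * ∑ k, (x k + t)⁻¹) ∧
    ∫ x : Fin n → ℝ, laguerreWeight β γ b x * ∑ k, (x k + t)⁻¹
      ≤ (Real.exp (n * b * t) - 1) / t / γ * ∫ x : Fin n → ℝ, laguerreWeight β γ b x := by
  have hW := integrable_laguerreWeight hβ (by linarith : -1 < γ) hb n
  have hWt := (hW.comp_add_right (fun _ ↦ t)).const_mul (Real.exp (n * b * t))
  have hle : ∀ x : Fin n → ℝ, laguerreWeight β γ b x * (1 + γ * t * ∑ k, (x k + t)⁻¹)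
      ≤ Real.exp (n * b * t) * laguerreWeight β γ b (x + fun _ ↦ t) := by
    intro x
    have h := mul_le_mul_of_nonneg_left (mul_one_add_sum_le_laguerreWeight_add (β := β) (b := b)
      hγ.le ht x) (Real.exp_pos (n * b * t)).le
    rwa [← mul_assoc, ← Real.exp_add, add_neg_cancel, Real.exp_zero, one_mul] at h
  have hnonneg : ∀ x : Fin n → ℝ, 0 ≤ laguerreWeight β γ b x * ∑ k, (x k + t)⁻¹ := by
    intro x
    by_cases hx : x ∈ configurations n
    · refine mul_nonneg (laguerreWeight_nonneg _ _ _ _) (Finset.sum_nonneg fun k _ ↦ ?_)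
      have := hx.1 k
      positivity
    · rw [laguerreWeight, Set.indicator_of_notMem hx, zero_mul]
  have hmeas : Measurable fun x : Fin n → ℝ ↦ laguerreWeight β γ b x * ∑ k, (x k + t)⁻¹ :=
    (measurable_laguerreWeight β γ b n).mul (by fun_prop)
  have hint : Integrable (fun x : Fin n → ℝ ↦ laguerreWeight β γ b x * ∑ k, (x k + t)⁻¹) := by
    refine (hWt.const_mul (γ * t)⁻¹).mono' hmeas.aestronglyMeasurable (.of_forall fun x ↦ ?_)
    rw [Real.norm_of_nonneg (hnonneg x), inv_mul_eq_div, le_div_iff₀ (by positivity)]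
    linarith [hle x, laguerreWeight_nonneg β γ b x]
  refine ⟨hint, ?_⟩
  have h := integral_mono (hW.add (hint.const_mul (γ * t))) hWt (fun x ↦ by
    have := hle x
    simp only [Pi.add_apply]
    linarith)
  simp only [Pi.add_apply] at h
  rw [integral_add hW (hint.const_mul _), integral_const_mul, integral_const_mul,
    integral_add_right_eq_self (fun x ↦ laguerreWeight β γ b x)] at h
  rw [div_div, div_mul_eq_mul_div, le_div_iff₀ (by positivity)]
  linarith

lemma tendsto_exp_mul_sub_one_div (a : ℝ) :
    Tendsto (fun m : ℕ ↦ (Real.exp (a * (1 / ((m : ℝ) + 1))) - 1) / (1 / ((m : ℝ) + 1)))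
      atTop (𝓝 a) := by
  have h : HasDerivAt (fun t ↦ Real.exp (a * t)) a 0 := by
    simpa using ((hasDerivAt_id (0 : ℝ)).const_mul a).exp
  have h1 := h.tendsto_slope_zero
  have h2 : Tendsto (fun m : ℕ ↦ 1 / ((m : ℝ) + 1)) atTop (𝓝[≠] 0) :=
    tendsto_nhdsWithin_iff.2 ⟨tendsto_one_div_add_atTop_nhds_zero_nat,
      .of_forall fun m ↦ by simp only [Set.mem_compl_iff, Set.mem_singleton_iff]; positivity⟩
  refine (h1.comp h2).congr fun m ↦ ?_
  simp [div_eq_inv_mul]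

/-- This replaces integrating the diagonal derivative of the weight by parts: let the shift `t = 1 /
(m + 1)` tend to zero in the previous bound, where `(exp (n b t) - 1) / t → n b`. No boundary terms
have to be examined. -/
lemma integrable_mul_sum_inv {β γ b : ℝ} (hβ : 0 < β) (hγ : 0 < γ) (hb : 0 < b) {n : ℕ} :
    Integrable (fun x : Fin n → ℝ ↦ laguerreWeight β γ b x * ∑ k, (x k)⁻¹) ∧
    ∫ x : Fin n → ℝ, laguerreWeight β γ b x * ∑ k, (x k)⁻¹
      ≤ n * b / γ * ∫ x : Fin n → ℝ, laguerreWeight β γ b x := by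
  set Z := ∫ x : Fin n → ℝ, laguerreWeight β γ b x with hZ
  have hZ0 : 0 ≤ Z := integral_nonneg (laguerreWeight_nonneg β γ b)
  set f : ℕ → (Fin n → ℝ) → ℝ :=
    fun m x ↦ laguerreWeight β γ b x * ∑ k, (x k + 1 / ((m : ℝ) + 1))⁻¹ with hf
  set g : (Fin n → ℝ) → ℝ := fun x ↦ laguerreWeight β γ b x * ∑ k, (x k)⁻¹ with hg
  have hfmeas : ∀ m, Measurable (f m) := fun m ↦
    (measurable_laguerreWeight β γ b n).mul (by fun_prop)
  have hgmeas : Measurable g := (measurable_laguerreWeight β γ b n).mul (by fun_prop)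
  have hg0 : ∀ x, 0 ≤ g x := by
    intro x
    by_cases hx : x ∈ configurations n
    · exact mul_nonneg (laguerreWeight_nonneg _ _ _ _)
        (Finset.sum_nonneg fun k _ ↦ (inv_pos.2 (hx.1 k)).le)
    · simp only [hg]
      rw [laguerreWeight, Set.indicator_of_notMem hx, zero_mul]
  have hf0 : ∀ m x, 0 ≤ f m x := by
    intro m x
    by_cases hx : x ∈ configurations n
    · refine mul_nonneg (laguerreWeight_nonneg _ _ _ _) (Finset.sum_nonneg fun k _ ↦ ?_)
      have := hx.1 k
      positivity
    · simp only [hf]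
      rw [laguerreWeight, Set.indicator_of_notMem hx, zero_mul]
  have hlim : ∀ x, Tendsto (fun m ↦ f m x) atTop (𝓝 (g x)) := by
    intro x
    by_cases hx : x ∈ configurations n
    · refine tendsto_const_nhds.mul (tendsto_finsetSum _ fun k _ ↦ ?_)
      refine Tendsto.inv₀ ?_ (hx.1 k).ne'
      simpa using tendsto_const_nhds.add (tendsto_one_div_add_atTop_nhds_zero_nat (𝕜 := ℝ))
    · have : laguerreWeight β γ b x = 0 := Set.indicator_of_notMem hx _
      simp [hf, hg, this]
  set B : ℕ → ℝ := fun m ↦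
    (Real.exp (n * b * (1 / ((m : ℝ) + 1))) - 1) / (1 / ((m : ℝ) + 1)) / γ * Z with hB
  have hBlim : Tendsto B atTop (𝓝 (n * b / γ * Z)) :=
    ((tendsto_exp_mul_sub_one_div (n * b)).div_const γ).mul_const Z
  have hfB : ∀ m, ∫⁻ x, ENNReal.ofReal (f m x) ≤ ENNReal.ofReal (B m) := by
    intro m
    have h := integrable_mul_sum_inv_add hβ hγ hb (n := n)
      (t := 1 / ((m : ℝ) + 1)) (by positivity)
    rw [← ofReal_integral_eq_lintegral_ofReal h.1 (.of_forall (hf0 m))]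
    exact ENNReal.ofReal_le_ofReal h.2
  -- Fatou's lemma yields finiteness and the bound together.
  have hgB : ∫⁻ x, ENNReal.ofReal (g x) ≤ ENNReal.ofReal (n * b / γ * Z) := by
    calc ∫⁻ x, ENNReal.ofReal (g x)
        = ∫⁻ x, liminf (fun m ↦ ENNReal.ofReal (f m x)) atTop :=
          lintegral_congr fun x ↦ ((ENNReal.tendsto_ofReal (hlim x)).liminf_eq).symm
      _ ≤ liminf (fun m ↦ ∫⁻ x, ENNReal.ofReal (f m x)) atTop :=
          lintegral_liminf_le fun m ↦ (hfmeas m).ennreal_ofReal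
      _ ≤ liminf (fun m ↦ ENNReal.ofReal (B m)) atTop := liminf_le_liminf (.of_forall hfB)
      _ = _ := (ENNReal.tendsto_ofReal hBlim).liminf_eq
  refine ⟨⟨hgmeas.aestronglyMeasurable, ?_⟩, ?_⟩
  · rw [hasFiniteIntegral_iff_ofReal (.of_forall hg0)]
    exact hgB.trans_lt ENNReal.ofReal_lt_top
  · rw [integral_eq_lintegral_of_nonneg_ae (.of_forall hg0) hgmeas.aestronglyMeasurable]
    exact ENNReal.toReal_le_of_le_ofReal (by positivity) hgB

/-! ### Normalization of the eigenvalue law -/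

variable {β : ℝ} {n : ℕ} {c : ℝ}

lemma exponent_eq (hβ : 0 < β) (hn : 1 ≤ n) (c : ℝ) :
    β * n * alpha β n c = β / 2 * (n * (c - 1) + 1) - 1 := by
  have hn' : (0 : ℝ) < n := by exact_mod_cast hn
  unfold alpha
  field_simp

lemma neg_one_lt_exponent (hβ : 0 < β) (hn : 1 ≤ n) (hc : 1 ≤ c) : -1 < β * n * alpha β n c := by
  have hn' : (1 : ℝ) ≤ n := by exact_mod_cast hn
  rw [exponent_eq hβ hn]
  have : 0 < β / 2 * (n * (c - 1) + 1) := by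
    have := mul_nonneg (zero_le_one.trans hn') (sub_nonneg.2 hc)
    positivity
  linarith

lemma integrable_boltzmannWeight (hβ : 0 < β) (hn : 1 ≤ n) (hc : 1 ≤ c) :
    Integrable (boltzmannWeight β n c) := by
  rw [boltzmannWeight_eq_laguerreWeight]
  have hn' : (0 : ℝ) < n := by exact_mod_cast hn
  exact integrable_laguerreWeight hβ (neg_one_lt_exponent hβ hn hc) (by positivity) n

lemma integral_boltzmannWeight_pos (hβ : 0 < β) (hn : 1 ≤ n) (hc : 1 ≤ c) :
    0 < ∫ x, boltzmannWeight β n c x := by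
  rw [boltzmannWeight_eq_laguerreWeight]
  have hn' : (0 : ℝ) < n := by exact_mod_cast hn
  exact integral_laguerreWeight_pos hβ (neg_one_lt_exponent hβ hn hc) (by positivity) n

lemma measurable_boltzmannWeight (β : ℝ) (n : ℕ) (c : ℝ) :
    Measurable (boltzmannWeight β n c) := by
  rw [boltzmannWeight_eq_laguerreWeight]
  exact measurable_laguerreWeight _ _ _ _

lemma boltzmannWeight_nonneg (β : ℝ) (n : ℕ) (c : ℝ) (x : Fin n → ℝ) :
    0 ≤ boltzmannWeight β n c x :=
  Set.indicator_nonneg (fun _ _ ↦ (Real.exp_pos _).le) x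

lemma partitionFunction_eq (hβ : 0 < β) (hn : 1 ≤ n) (hc : 1 ≤ c) :
    partitionFunction β n c = ENNReal.ofReal (∫ x, boltzmannWeight β n c x) :=
  (ofReal_integral_eq_lintegral_ofReal (integrable_boltzmannWeight hβ hn hc)
    (.of_forall (boltzmannWeight_nonneg β n c))).symm

lemma partitionFunction_ne_zero (hβ : 0 < β) (hn : 1 ≤ n) (hc : 1 ≤ c) :
    partitionFunction β n c ≠ 0 := by
  rw [partitionFunction_eq hβ hn hc]
  simpa using integral_boltzmannWeight_pos hβ hn hc

lemma partitionFunction_ne_top (hβ : 0 < β) (hn : 1 ≤ n) (hc : 1 ≤ c) :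
    partitionFunction β n c ≠ ⊤ := by
  rw [partitionFunction_eq hβ hn hc]
  exact ENNReal.ofReal_ne_top

lemma isProbabilityMeasure_eigenvalueLaw (hβ : 0 < β) (hn : 1 ≤ n) (hc : 1 ≤ c) :
    IsProbabilityMeasure (eigenvalueLaw β n c) := by
  refine ⟨?_⟩
  rw [eigenvalueLaw, Measure.smul_apply, withDensity_apply _ .univ, Measure.restrict_univ,
    smul_eq_mul]
  exact ENNReal.inv_mul_cancel (partitionFunction_ne_zero hβ hn hc)
    (partitionFunction_ne_top hβ hn hc)

lemma integral_eigenvalueLaw (hβ : 0 < β) (hn : 1 ≤ n) (hc : 1 ≤ c) (g : (Fin n → ℝ) → ℝ) :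
    ∫ x, g x ∂(eigenvalueLaw β n c)
      = (∫ x, boltzmannWeight β n c x * g x) / ∫ x, boltzmannWeight β n c x := by
  rw [eigenvalueLaw, integral_smul_measure, integral_withDensity_eq_integral_toReal_smul
    (measurable_boltzmannWeight β n c).ennreal_ofReal (.of_forall fun _ ↦ ENNReal.ofReal_lt_top),
    partitionFunction_eq hβ hn hc, ENNReal.toReal_inv,
    ENNReal.toReal_ofReal (integral_boltzmannWeight_pos hβ hn hc).le, smul_eq_mul,
    inv_mul_eq_div]
  simp only [ENNReal.toReal_ofReal (boltzmannWeight_nonneg β n c _), smul_eq_mul]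

lemma integrable_eigenvalueLaw_iff (hβ : 0 < β) (hn : 1 ≤ n) (hc : 1 ≤ c)
    (g : (Fin n → ℝ) → ℝ) :
    Integrable g (eigenvalueLaw β n c) ↔ Integrable fun x ↦ boltzmannWeight β n c x * g x := by
  rw [eigenvalueLaw, integrable_smul_measure
    (ENNReal.inv_ne_zero.2 (partitionFunction_ne_top hβ hn hc))
    (ENNReal.inv_ne_top.2 (partitionFunction_ne_zero hβ hn hc)),
    integrable_withDensity_iff_integrable_smul' (measurable_boltzmannWeight β n c).ennreal_ofReal
      (.of_forall fun _ ↦ ENNReal.ofReal_lt_top)]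
  simp only [ENNReal.toReal_ofReal (boltzmannWeight_nonneg β n c _), smul_eq_mul]

lemma ae_mem_configurations (β : ℝ) (n : ℕ) (c : ℝ) :
    ∀ᵐ x ∂(eigenvalueLaw β n c), x ∈ configurations n := by
  refine Measure.ae_smul_measure ?_ _
  rw [ae_withDensity_iff (measurable_boltzmannWeight β n c).ennreal_ofReal]
  refine .of_forall fun x hx ↦ ?_
  by_contra h
  exact hx (by rw [boltzmannWeight, Set.indicator_of_notMem h, ENNReal.ofReal_zero])

/-! ### The trace: exact gamma law and Gaussian limit -/

/-- The shape parameter of the gamma distribution that the trace follows. -/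
def traceShape (β : ℝ) (n : ℕ) (c : ℝ) : ℝ := β * c * (n : ℝ) ^ 2 / 2

lemma traceShape_pos (hβ : 0 < β) (hn : 1 ≤ n) (hc : 1 ≤ c) : 0 < traceShape β n c := by
  have hn' : (0 : ℝ) < n := by exact_mod_cast hn
  have hc' : 0 < c := by linarith
  unfold traceShape
  positivity

/-- The tilt turns the rate `b = n β / 2` into `b r`, so the expectation is a ratio of two
normalization constants. The chosen `alpha` makes the scaling exponent collapse to exactly `β c n² /
2`. -/
lemma exp_mul_sum_eigenvalueLaw (hβ : 0 < β) (hn : 1 ≤ n) (hc : 1 ≤ c) {r : ℝ} (hr : 0 < r) :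
    Integrable (fun x : Fin n → ℝ ↦ Real.exp (n * β / 2 * (1 - r) * ∑ k, x k))
      (eigenvalueLaw β n c) ∧
    ∫ x : Fin n → ℝ, Real.exp (n * β / 2 * (1 - r) * ∑ k, x k) ∂(eigenvalueLaw β n c)
      = r ^ (-traceShape β n c) := by
  have hn' : (0 : ℝ) < n := by exact_mod_cast hn
  have hmul : ∀ x : Fin n → ℝ,
      boltzmannWeight β n c x * Real.exp (n * β / 2 * (1 - r) * ∑ k, x k)
        = laguerreWeight β (β * n * alpha β n c) (n * β / 2 * r) x := by
    intro x
    rw [boltzmannWeight_eq_laguerreWeight]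
    unfold laguerreWeight
    by_cases hx : x ∈ configurations n
    · rw [Set.indicator_of_mem hx, Set.indicator_of_mem hx, ← Real.exp_add]
      ring_nf
    · rw [Set.indicator_of_notMem hx, Set.indicator_of_notMem hx, zero_mul]
  constructor
  · rw [integrable_eigenvalueLaw_iff hβ hn hc]
    simp only [hmul]
    exact integrable_laguerreWeight hβ (neg_one_lt_exponent hβ hn hc) (by positivity) n
  · rw [integral_eigenvalueLaw hβ hn hc]
    simp only [hmul]
    have h0 := integral_boltzmannWeight_pos hβ hn hc
    rw [integral_laguerreWeight_mul _ _ _ _ hr, ← boltzmannWeight_eq_laguerreWeight,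
      mul_div_cancel_right₀ _ h0.ne']
    congr 2
    unfold traceShape alpha
    field_simp
    ring

lemma normalizedTrace_eq (hn : 1 ≤ n) (hc : 1 ≤ c) (x : Fin n → ℝ) :
    normalizedTrace β n c x
      = √(traceShape β n c) / (n * c) * (∑ k, x k) - √(traceShape β n c) := by
  have hn' : (0 : ℝ) < n := by exact_mod_cast hn
  have hc' : 0 < c := by linarith
  have h : √(β * (n : ℝ) ^ 2 / (2 * c)) = √(traceShape β n c) / c := by
    rw [show β * (n : ℝ) ^ 2 / (2 * c) = traceShape β n c / c ^ 2 by
      unfold traceShape; field_simp, Real.sqrt_div' _ (by positivity), Real.sqrt_sq hc'.le]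
  rw [normalizedTrace, h, scaledTrace]
  field_simp

lemma exp_mul_normalizedTrace (hβ : 0 < β) (hn : 1 ≤ n) (hc : 1 ≤ c) {s : ℝ}
    (hs : s < √(traceShape β n c)) :
    Integrable (fun x ↦ Real.exp (s * normalizedTrace β n c x)) (eigenvalueLaw β n c) ∧
    mgf (normalizedTrace β n c) (eigenvalueLaw β n c) s
      = (1 - s / √(traceShape β n c)) ^ (-traceShape β n c)
        * Real.exp (-(s * √(traceShape β n c))) := by
  have hn' : (0 : ℝ) < n := by exact_mod_cast hn
  have hc' : 0 < c := by linarith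
  have hK := traceShape_pos hβ hn hc
  have hw : 0 < √(traceShape β n c) := Real.sqrt_pos.2 hK
  have hr : 0 < 1 - s / √(traceShape β n c) := by
    rw [sub_pos, div_lt_one hw]
    exact hs
  have key := exp_mul_sum_eigenvalueLaw hβ hn hc hr
  have hcoef : n * β / 2 * (1 - (1 - s / √(traceShape β n c)))
      = s * (√(traceShape β n c) / (n * c)) := by
    have h2 : √(traceShape β n c) ^ 2 = traceShape β n c := Real.sq_sqrt hK.le
    field_simp
    rw [h2, traceShape]
    ring
  have hexp : ∀ x : Fin n → ℝ, Real.exp (s * normalizedTrace β n c x)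
      = Real.exp (n * β / 2 * (1 - (1 - s / √(traceShape β n c))) * ∑ k, x k)
        * Real.exp (-(s * √(traceShape β n c))) := by
    intro x
    rw [normalizedTrace_eq hn hc, hcoef, ← Real.exp_add]
    ring_nf
  constructor
  · simp only [hexp]
    exact key.1.mul_const _
  · simp only [mgf, hexp]
    rw [integral_mul_const, key.2]

lemma Iio_subset_integrableExpSet (hβ : 0 < β) (hn : 1 ≤ n) (hc : 1 ≤ c) :
    Set.Iio (√(traceShape β n c)) ⊆
      interior (integrableExpSet (normalizedTrace β n c) (eigenvalueLaw β n c)) :=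
  interior_maximal (fun _ hs ↦ (exp_mul_normalizedTrace hβ hn hc hs).1) isOpen_Iio

lemma measurable_normalizedTrace (β : ℝ) (n : ℕ) (c : ℝ) : Measurable (normalizedTrace β n c) := by
  unfold normalizedTrace scaledTrace
  fun_prop

lemma measurable_normalizedLogDet (β : ℝ) (n : ℕ) (c : ℝ) :
    Measurable (normalizedLogDet β n c) := by
  unfold normalizedLogDet scaledLogDet
  fun_prop

/-- The moment generating function is known on real `s < w`. Both sides are analytic on the
half-plane `re z < w`, where `1 - z / w` has positive real part and so avoids the cut of the
logarithm. The identity theorem carries the formula to the imaginary axis. -/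
lemma charFun_map_normalizedTrace (hβ : 0 < β) (hn : 1 ≤ n) (hc : 1 ≤ c) (t : ℝ) :
    charFun ((eigenvalueLaw β n c).map (normalizedTrace β n c)) t
      = Complex.exp (-(√(traceShape β n c) : ℂ) ^ 2
          * Complex.log (1 + -(t * Complex.I) / √(traceShape β n c))
        - t * Complex.I * √(traceShape β n c)) := by
  set w := √(traceShape β n c) with hw_def
  have hK := traceShape_pos hβ hn hc
  have hw : 0 < w := Real.sqrt_pos.2 hK
  have hw2 : traceShape β n c = w ^ 2 := (Real.sq_sqrt hK.le).symm
  set U : Set ℂ := {z | z.re < w} with hU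
  have hUopen : IsOpen U := isOpen_lt Complex.continuous_re continuous_const
  have hf : AnalyticOnNhd ℂ
      (complexMGF (normalizedTrace β n c) (eigenvalueLaw β n c)) U :=
    analyticOnNhd_complexMGF.mono fun z hz ↦ Iio_subset_integrableExpSet hβ hn hc hz
  have hslit : ∀ z ∈ U, 1 + -z / (w : ℂ) ∈ Complex.slitPlane := by
    intro z hz
    left
    have hz' : z.re < w := hz
    have h1 : z.re / w < 1 := (div_lt_one hw).2 hz'
    rw [Complex.add_re, Complex.one_re, Complex.div_ofReal_re, Complex.neg_re, neg_div]
    linarith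
  have hg : AnalyticOnNhd ℂ (fun z : ℂ ↦ Complex.exp (-(w : ℂ) ^ 2
      * Complex.log (1 + -z / w) - z * w)) U := by
    refine DifferentiableOn.analyticOnNhd (fun z hz ↦ ?_) hUopen
    have := hslit z hz
    refine DifferentiableAt.differentiableWithinAt ?_
    fun_prop (disch := assumption)
  have hconv : IsPreconnected U := (convex_halfSpace_re_lt w).isPreconnected
  have heq : ∃ᶠ z in 𝓝[≠] (0 : ℂ),
      complexMGF (normalizedTrace β n c) (eigenvalueLaw β n c) z
        = Complex.exp (-(w : ℂ) ^ 2 * Complex.log (1 + -z / w) - z * w) := by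
    have hreal : ∀ s : ℝ, s < w →
        complexMGF (normalizedTrace β n c) (eigenvalueLaw β n c) s
          = Complex.exp (-(w : ℂ) ^ 2 * Complex.log (1 + -(s : ℂ) / w) - s * w) := by
      intro s hs
      have hr : 0 < 1 - s / w := sub_pos.2 ((div_lt_one hw).2 hs)
      rw [complexMGF_ofReal, (exp_mul_normalizedTrace hβ hn hc hs).2, ← hw_def,
        Real.rpow_def_of_pos hr, ← Real.exp_add, hw2, Complex.ofReal_exp]
      congr 1
      have : 1 + -(s : ℂ) / w = ((1 - s / w : ℝ) : ℂ) := by push_cast; ring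
      rw [this, ← Complex.ofReal_log hr.le]
      push_cast
      ring
    -- The real points `-1 / (m + 1)` accumulate at `0` inside the half-plane, which suffices for
    -- the identity theorem.
    rw [frequently_iff_seq_forall]
    refine ⟨fun m : ℕ ↦ ((-(1 / ((m : ℝ) + 1)) : ℝ) : ℂ), ?_, fun m ↦ hreal _ ?_⟩
    · refine tendsto_nhdsWithin_iff.2 ⟨?_, .of_forall fun m ↦ ?_⟩
      · have h := (tendsto_one_div_add_atTop_nhds_zero_nat (𝕜 := ℝ)).neg
        rw [neg_zero] at h
        exact (Complex.continuous_ofReal.tendsto 0).comp h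
      · have : (-(1 / ((m : ℝ) + 1)) : ℝ) ≠ 0 := neg_ne_zero.2 (by positivity)
        exact Complex.ofReal_ne_zero.2 this
    · have : 0 < 1 / ((m : ℝ) + 1) := by positivity
      linarith
  have h := hf.eqOn_of_preconnected_of_frequently_eq hg hconv (z₀ := 0) (by simpa [hU] using hw) heq
  rw [← complexMGF_mul_I (measurable_normalizedTrace β n c).aemeasurable]
  exact h (by simpa [hU] using hw)

/-- With `z = -i t / w`, the linear Taylor term of `log (1 + z)` cancels `i t w`, the quadratic one
gives `-t² / 2`, and the cubic remainder times `w²` is `O(1 / w)`. -/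
lemma tendsto_exp_neg_sq_mul_log (t : ℝ) :
    Tendsto (fun w : ℝ ↦ Complex.exp (-(w : ℂ) ^ 2
      * Complex.log (1 + -(t * Complex.I) / w) - t * Complex.I * w)) atTop
      (𝓝 (Complex.exp (-t ^ 2 / 2))) := by
  refine (Complex.continuous_exp.tendsto _).comp ?_
  rw [tendsto_iff_norm_sub_tendsto_zero]
  have hlim : Tendsto (fun w : ℝ ↦ 2 * |t| ^ 3 / w) atTop (𝓝 0) :=
    tendsto_const_nhds.div_atTop tendsto_id
  refine squeeze_zero' (.of_forall fun _ ↦ norm_nonneg _) ?_ hlim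
  filter_upwards [eventually_gt_atTop 0, eventually_ge_atTop (2 * |t|)] with w hw hwt
  have hwC : (w : ℂ) ≠ 0 := by exact_mod_cast hw.ne'
  set z : ℂ := -(t * Complex.I) / w with hz
  have hznorm : ‖z‖ = |t| / w := by
    simp [hz, abs_of_pos hw]
  have hzle : ‖z‖ ≤ 1 / 2 := by
    rw [hznorm, div_le_iff₀ hw]
    linarith
  have hT := Complex.norm_log_sub_logTaylor_le 2 (z := z) (by linarith)
  have hTay : Complex.logTaylor (2 + 1) z = z - z ^ 2 / 2 := by
    simp [Complex.logTaylor, Finset.sum_range_succ]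
    ring
  have hid : -(w : ℂ) ^ 2 * Complex.log (1 + z) - t * Complex.I * w - -(t : ℂ) ^ 2 / 2
      = -(w : ℂ) ^ 2 * (Complex.log (1 + z) - (z - z ^ 2 / 2)) := by
    have h1 : (w : ℂ) ^ 2 * z = - (t * Complex.I * w) := by
      rw [hz]; field_simp
    have h2 : (w : ℂ) ^ 2 * z ^ 2 = - t ^ 2 := by
      rw [hz, div_pow, neg_sq, mul_pow, Complex.I_sq]; field_simp
    linear_combination h2 / 2 - h1
  rw [hid, norm_mul, ← hTay]
  have hnw : ‖-(w : ℂ) ^ 2‖ = w ^ 2 := by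
    rw [norm_neg, norm_pow, Complex.norm_real, Real.norm_of_nonneg hw.le]
  rw [hnw]
  have hinv : (1 - ‖z‖)⁻¹ ≤ 2 := by
    rw [inv_le_comm₀ (by linarith) two_pos]
    linarith
  calc w ^ 2 * ‖Complex.log (1 + z) - Complex.logTaylor (2 + 1) z‖
      ≤ w ^ 2 * (‖z‖ ^ 3 * 2) := by
        refine mul_le_mul_of_nonneg_left (hT.trans ?_) (by positivity)
        have h3 := mul_le_mul_of_nonneg_left hinv (pow_nonneg (norm_nonneg z) 3)
        have h4 : 0 ≤ ‖z‖ ^ 3 * 2 := by positivity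
        norm_num at h3 ⊢
        linarith
    _ = 2 * |t| ^ 3 / w := by
        rw [hznorm]
        field_simp

lemma integrable_normalizedTrace (hβ : 0 < β) (hn : 1 ≤ n) (hc : 1 ≤ c) :
    Integrable (normalizedTrace β n c) (eigenvalueLaw β n c) := by
  have h0 := Iio_subset_integrableExpSet hβ hn hc
    (show (0 : ℝ) ∈ Set.Iio _ from Real.sqrt_pos.2 (traceShape_pos hβ hn hc))
  simpa using integrable_pow_of_mem_interior_integrableExpSet h0 1

lemma integral_normalizedTrace (hβ : 0 < β) (hn : 1 ≤ n) (hc : 1 ≤ c) :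
    ∫ x, normalizedTrace β n c x ∂(eigenvalueLaw β n c) = 0 := by
  have hK := traceShape_pos hβ hn hc
  have hw : 0 < √(traceShape β n c) := Real.sqrt_pos.2 hK
  have h0 := Iio_subset_integrableExpSet hβ hn hc (show (0 : ℝ) ∈ Set.Iio _ from hw)
  rw [← deriv_mgf_zero h0]
  have heq : mgf (normalizedTrace β n c) (eigenvalueLaw β n c) =ᶠ[𝓝 0]
      fun s ↦ (1 - s / √(traceShape β n c)) ^ (-traceShape β n c)
        * Real.exp (-(s * √(traceShape β n c))) := by
    filter_upwards [isOpen_Iio.mem_nhds (show (0 : ℝ) ∈ Set.Iio _ from hw)] with s hs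
    exact (exp_mul_normalizedTrace hβ hn hc hs).2
  rw [heq.deriv_eq]
  have h1 : HasDerivAt (fun s ↦ 1 - s / √(traceShape β n c))
      (-(1 / √(traceShape β n c))) 0 :=
    ((hasDerivAt_id (0 : ℝ)).div_const _).const_sub 1
  have h2 := h1.rpow_const (p := -traceShape β n c) (Or.inl (by simp))
  have h3 : HasDerivAt (fun s ↦ Real.exp (-(s * √(traceShape β n c))))
      (-√(traceShape β n c)) 0 := by
    simpa using (((hasDerivAt_id (0 : ℝ)).mul_const (√(traceShape β n c))).fun_neg).exp
  refine (h2.mul h3).deriv.trans ?_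
  have h4 : traceShape β n c / √(traceShape β n c) = √(traceShape β n c) := Real.div_sqrt
  simp only [zero_div, sub_zero, Real.one_rpow, zero_mul, neg_zero, Real.exp_zero]
  linear_combination h4

/-! ### Comparison of the log-determinant with the trace -/

/-- The exponent is `β / 2 * (n (c - 1) + 1) - 1`. From `c ≥ 2` the main term is at least `β n c /
4`, and `c ≥ 8 / β` lets half of that absorb the `-1`. -/
lemma le_exponent (hβ : 0 < β) (hn : 1 ≤ n) (hc : 2 ≤ c) (hcβ : 8 / β ≤ c) :
    β * n * c / 8 ≤ β * n * alpha β n c := by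
  have hn' : (1 : ℝ) ≤ n := by exact_mod_cast hn
  rw [exponent_eq hβ hn]
  rw [div_le_iff₀ hβ] at hcβ
  have h1 : 0 ≤ β * n * (c - 2) := by
    have := sub_nonneg.2 hc
    positivity
  have h2 : 0 ≤ (n - 1) * (c * β) := by
    have := sub_nonneg.2 hn'
    have : 0 < c := by linarith
    positivity
  nlinarith

lemma normalizedTrace_sub_normalizedLogDet (hn : 1 ≤ n) (hc : 1 ≤ c) {x : Fin n → ℝ}
    (hx : ∀ i, 0 < x i) :
    normalizedTrace β n c x - normalizedLogDet β n c x
      = √(traceShape β n c) / n * ∑ k, (x k / c - 1 - Real.log (x k / c)) := by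
  have hn' : (0 : ℝ) < n := by exact_mod_cast hn
  have hc' : 0 < c := by linarith
  have h : ∑ k, (x k / c - 1 - Real.log (x k / c))
      = (∑ k, x k) / c - n - (∑ k, Real.log (x k) - n * Real.log c) := by
    simp only [Real.log_div (hx _).ne' hc'.ne', Finset.sum_sub_distrib, Finset.sum_div]
    simp
  rw [normalizedTrace_eq hn hc, h, normalizedLogDet, scaledLogDet, traceShape]
  field_simp

lemma normalizedTrace_sub_normalizedLogDet_nonneg (hn : 1 ≤ n) (hc : 1 ≤ c) {x : Fin n → ℝ}
    (hx : ∀ i, 0 < x i) : 0 ≤ normalizedTrace β n c x - normalizedLogDet β n c x := by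
  rw [normalizedTrace_sub_normalizedLogDet hn hc hx]
  refine mul_nonneg (by positivity) (Finset.sum_nonneg fun k _ ↦ ?_)
  have := Real.log_le_sub_one_of_pos (div_pos (hx k) (by linarith : 0 < c))
  linarith

/-- Use `ln y ≥ 1 - 1 / y` at `y = x k / c`. The terms linear in `y` reassemble into the normalized
trace, which drops out in the mean. -/
lemma normalizedTrace_sub_normalizedLogDet_le (hn : 1 ≤ n) (hc : 1 ≤ c) {x : Fin n → ℝ}
    (hx : ∀ i, 0 < x i) :
    normalizedTrace β n c x - normalizedLogDet β n c x
      ≤ normalizedTrace β n c x + √(traceShape β n c) * (c / n * (∑ k, (x k)⁻¹) - 1) := by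
  have hn' : (0 : ℝ) < n := by exact_mod_cast hn
  have hc' : 0 < c := by linarith
  have h1 : ∑ k, (x k / c - 1 - Real.log (x k / c)) ≤ ∑ k, (x k / c + c * (x k)⁻¹ - 2) := by
    refine Finset.sum_le_sum fun k _ ↦ ?_
    have h := Real.one_sub_inv_le_log_of_pos (div_pos (hx k) hc')
    rw [inv_div, div_eq_mul_inv c] at h
    linarith
  have h2 : ∑ k, (x k / c + c * (x k)⁻¹ - 2) = (∑ k, x k) / c + c * ∑ k, (x k)⁻¹ - 2 * n := by
    simp only [Finset.sum_sub_distrib, Finset.sum_add_distrib, ← Finset.sum_div, ← Finset.mul_sum]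
    simp [mul_comm]
  rw [normalizedTrace_sub_normalizedLogDet hn hc hx]
  refine (mul_le_mul_of_nonneg_left h1 (by positivity)).trans_eq ?_
  rw [h2, normalizedTrace_eq hn hc]
  field_simp
  ring

lemma sum_inv_eigenvalueLaw (hβ : 0 < β) (hn : 1 ≤ n) (hc : 1 ≤ c)
    (hγ : 0 < β * n * alpha β n c) :
    Integrable (fun x : Fin n → ℝ ↦ ∑ k, (x k)⁻¹) (eigenvalueLaw β n c) ∧
    ∫ x : Fin n → ℝ, ∑ k, (x k)⁻¹ ∂(eigenvalueLaw β n c)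
      ≤ n * (n * β / 2) / (β * n * alpha β n c) := by
  have hn' : (0 : ℝ) < n := by exact_mod_cast hn
  have h := integrable_mul_sum_inv hβ hγ (by positivity : 0 < n * β / 2) (n := n)
  rw [← boltzmannWeight_eq_laguerreWeight] at h
  refine ⟨(integrable_eigenvalueLaw_iff hβ hn hc _).2 h.1, ?_⟩
  rw [integral_eigenvalueLaw hβ hn hc, div_le_iff₀ (integral_boltzmannWeight_pos hβ hn hc)]
  exact h.2

lemma normalizedTrace_sub_normalizedLogDet_eigenvalueLaw (hβ : 0 < β) (hn : 1 ≤ n) (hc : 2 ≤ c)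
    (hcβ : 8 / β ≤ c) :
    Integrable (fun x ↦ normalizedTrace β n c x - normalizedLogDet β n c x)
      (eigenvalueLaw β n c) ∧
    ∫ x, |normalizedTrace β n c x - normalizedLogDet β n c x| ∂(eigenvalueLaw β n c)
      ≤ √(β / 2) * (8 * (β / 2 + 1) / β) * √((n : ℝ) ^ 2 / c) := by
  have hn' : (1 : ℝ) ≤ n := by exact_mod_cast hn
  have hn0 : (0 : ℝ) < n := by linarith
  have hc1 : 1 ≤ c := by linarith
  have hc0 : 0 < c := by linarith
  have hγle := le_exponent hβ hn hc hcβ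
  have hγeq := exponent_eq hβ hn c
  have hγ : 0 < β * n * alpha β n c := lt_of_lt_of_le (by positivity) hγle
  have hprob := isProbabilityMeasure_eigenvalueLaw hβ hn hc1
  obtain ⟨hinv, hinvle⟩ := sum_inv_eigenvalueLaw hβ hn hc1 hγ
  set γ := β * n * alpha β n c with hγ_def
  set w := √(traceShape β n c) with hw
  have hY := integrable_normalizedTrace hβ hn hc1
  have hV : Integrable (fun x : Fin n → ℝ ↦ w * (c / n * (∑ k, (x k)⁻¹) - 1))
      (eigenvalueLaw β n c) :=
    ((hinv.const_mul (c / n)).sub (integrable_const (1 : ℝ))).const_mul w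
  have hbound : Integrable (fun x ↦ normalizedTrace β n c x
      + w * (c / n * (∑ k, (x k)⁻¹) - 1)) (eigenvalueLaw β n c) := hY.add hV
  have hmeas : Measurable fun x ↦ normalizedTrace β n c x - normalizedLogDet β n c x :=
    (measurable_normalizedTrace β n c).sub (measurable_normalizedLogDet β n c)
  have hle : ∀ᵐ x ∂(eigenvalueLaw β n c),
      |normalizedTrace β n c x - normalizedLogDet β n c x|
        ≤ normalizedTrace β n c x + w * (c / n * (∑ k, (x k)⁻¹) - 1) := by
    filter_upwards [ae_mem_configurations β n c] with x hx
    rw [abs_of_nonneg (normalizedTrace_sub_normalizedLogDet_nonneg hn hc1 hx.1)]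
    exact normalizedTrace_sub_normalizedLogDet_le hn hc1 hx.1
  have hint : Integrable (fun x ↦ normalizedTrace β n c x - normalizedLogDet β n c x)
      (eigenvalueLaw β n c) :=
    hbound.mono' hmeas.aestronglyMeasurable hle
  refine ⟨hint, (integral_mono_ae hint.abs hbound hle).trans ?_⟩
  have hV_eq : ∫ x : Fin n → ℝ, w * (c / n * (∑ k, (x k)⁻¹) - 1) ∂(eigenvalueLaw β n c)
      = w * (c / n * (∫ x : Fin n → ℝ, ∑ k, (x k)⁻¹ ∂(eigenvalueLaw β n c)) - 1) := by
    rw [integral_const_mul, integral_sub (hinv.const_mul _) (integrable_const _),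
      integral_const_mul]
    simp
  rw [integral_add hY hV, integral_normalizedTrace hβ hn hc1, zero_add]
  refine hV_eq.trans_le ?_
  -- The leading order cancels: the bound on the mean of `∑ 1 / x k` is `n / c` up to a relative
  -- error `(β / 2 * (n - 1) + 1) / γ`, which is `O(1 / c)` uniformly in `n`. Multiplied by `w`, of
  -- order `n √c`, it gives the rate `√(n² / c)`.
  have h1 : c / n * (∫ x : Fin n → ℝ, ∑ k, (x k)⁻¹ ∂(eigenvalueLaw β n c)) - 1
      ≤ 8 * (β / 2 + 1) / β / c := by
    have h2 := mul_le_mul_of_nonneg_left hinvle (by positivity : 0 ≤ c / n)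
    have h3 : c / n * (n * (n * β / 2) / γ) - 1 = (β / 2 * (n - 1) + 1) / γ := by
      field_simp
      rw [hγeq]
      ring
    have h4 : (β / 2 * (n - 1) + 1) / γ ≤ (β / 2 + 1) * n / (β * n * c / 8) := by
      refine div_le_div₀ (by positivity) ?_ (by positivity) hγle
      nlinarith
    have h5 : (β / 2 + 1) * n / (β * n * c / 8) = 8 * (β / 2 + 1) / β / c := by
      field_simp
    linarith
  refine (mul_le_mul_of_nonneg_left h1 (Real.sqrt_nonneg _)).trans_eq ?_
  have h6 : w = √(β / 2) * √((n : ℝ) ^ 2 / c) * c := by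
    rw [hw, ← Real.sqrt_mul (by positivity)]
    nth_rewrite 3 [← Real.sqrt_sq hc0.le]
    rw [← Real.sqrt_mul (by positivity), traceShape]
    congr 1
    field_simp
  rw [← hw, h6]
  field_simp

/-! ### Convergence of characteristic functions and Lévy's theorem -/

/-- The map `x ↦ exp (i t x)` is `|t|`-Lipschitz, so `L¹` closeness on one probability space is
enough to transfer the limit. -/
lemma norm_charFun_map_sub_le {Ω : Type*} [MeasurableSpace Ω] {μ : Measure Ω}
    [IsProbabilityMeasure μ] {X Y : Ω → ℝ} (hX : AEMeasurable X μ) (hY : AEMeasurable Y μ)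
    (hXY : Integrable (fun ω ↦ X ω - Y ω) μ) (t : ℝ) :
    ‖charFun (μ.map Y) t - charFun (μ.map X) t‖ ≤ |t| * ∫ ω, |X ω - Y ω| ∂μ := by
  have hint : ∀ {Z : Ω → ℝ}, AEMeasurable Z μ →
      Integrable (fun ω ↦ Complex.exp (t * Complex.I * Z ω)) μ := by
    intro Z hZ
    refine Integrable.of_bound (C := 1) (by fun_prop) (.of_forall fun ω ↦ ?_)
    rw [show (t * Complex.I * Z ω : ℂ) = ((t * Z ω : ℝ) : ℂ) * Complex.I by push_cast; ring,
      Complex.norm_exp_ofReal_mul_I]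
  rw [← complexMGF_mul_I hX, ← complexMGF_mul_I hY, complexMGF, complexMGF,
    ← integral_sub (hint hY) (hint hX), ← integral_const_mul]
  refine norm_integral_le_of_norm_le (hXY.abs.const_mul _) (.of_forall fun ω ↦ ?_)
  have h : Complex.exp (t * Complex.I * Y ω) - Complex.exp (t * Complex.I * X ω)
      = Complex.exp (((t * X ω : ℝ) : ℂ) * Complex.I)
        * (Complex.exp (Complex.I * ((t * (Y ω - X ω) : ℝ) : ℂ)) - 1) := by
    rw [mul_sub, ← Complex.exp_add, mul_one]
    push_cast
    ring_nf
  rw [h, norm_mul, Complex.norm_exp_ofReal_mul_I, one_mul]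
  refine Real.norm_exp_I_mul_ofReal_sub_one_le.trans_eq ?_
  rw [Real.norm_eq_abs, abs_mul, abs_sub_comm]

lemma tendsto_charFun_normalizedTrace (hβ : 0 < β) {ι : Type*} {l : Filter ι} {n : ι → ℕ}
    {c : ι → ℝ} (hn : ∀ i, 1 ≤ n i) (hc : ∀ i, 1 ≤ c i) (hlim : Tendsto c l atTop) (t : ℝ) :
    Tendsto (fun i ↦ charFun ((eigenvalueLaw β (n i) (c i)).map
      (normalizedTrace β (n i) (c i))) t) l (𝓝 (charFun (gaussianReal 0 1) t)) := by
  have hg : charFun (gaussianReal 0 1) t = Complex.exp (-t ^ 2 / 2) := by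
    rw [charFun_gaussianReal]
    congr 1
    push_cast
    ring
  rw [hg]
  -- Since `n ≥ 1`, the shape is at least `β c / 2` however `n` behaves.
  have hK : Tendsto (fun i ↦ √(traceShape β (n i) (c i))) l atTop := by
    refine Real.tendsto_sqrt_atTop.comp (tendsto_atTop_mono (fun i ↦ ?_)
      (hlim.const_mul_atTop (half_pos hβ)))
    have hn' : (1 : ℝ) ≤ (n i : ℝ) ^ 2 := one_le_pow₀ (by exact_mod_cast hn i)
    have := mul_le_mul_of_nonneg_left hn'
      (mul_nonneg (half_pos hβ).le (zero_le_one.trans (hc i)))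
    unfold traceShape
    linarith
  refine ((tendsto_exp_neg_sq_mul_log t).comp hK).congr fun i ↦ ?_
  rw [charFun_map_normalizedTrace hβ (hn i) (hc i)]
  rfl

lemma tendsto_charFun_normalizedLogDet (hβ : 0 < β) {ι : Type*} {l : Filter ι} {n : ι → ℕ}
    {c : ι → ℝ} (hn : ∀ i, 1 ≤ n i) (hc : ∀ i, 1 ≤ c i) (hlim : Tendsto c l atTop)
    (hnc : Tendsto (fun i ↦ (n i : ℝ) ^ 2 / c i) l (𝓝 0)) (t : ℝ) :
    Tendsto (fun i ↦ charFun ((eigenvalueLaw β (n i) (c i)).map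
      (normalizedLogDet β (n i) (c i))) t) l (𝓝 (charFun (gaussianReal 0 1) t)) := by
  have hT := tendsto_charFun_normalizedTrace hβ hn hc hlim t
  have hdiff : Tendsto (fun i ↦
      charFun ((eigenvalueLaw β (n i) (c i)).map (normalizedLogDet β (n i) (c i))) t
      - charFun ((eigenvalueLaw β (n i) (c i)).map (normalizedTrace β (n i) (c i))) t)
      l (𝓝 0) := by
    have hbound : Tendsto (fun i ↦ |t| * (√(β / 2) * (8 * (β / 2 + 1) / β)
        * √((n i : ℝ) ^ 2 / c i))) l (𝓝 0) := by
      have h := (((Real.continuous_sqrt.tendsto 0).comp hnc).const_mul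
        (√(β / 2) * (8 * (β / 2 + 1) / β))).const_mul |t|
      simpa using h
    refine squeeze_zero_norm' ?_ hbound
    filter_upwards [hlim.eventually_ge_atTop 2, hlim.eventually_ge_atTop (8 / β)] with i h2 h8
    have := isProbabilityMeasure_eigenvalueLaw hβ (hn i) (hc i)
    have h := normalizedTrace_sub_normalizedLogDet_eigenvalueLaw hβ (hn i) h2 h8
    exact (norm_charFun_map_sub_le (measurable_normalizedTrace _ _ _).aemeasurable
      (measurable_normalizedLogDet _ _ _).aemeasurable h.1 t).trans
      (mul_le_mul_of_nonneg_left h.2 (abs_nonneg t))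
  simpa using hdiff.add hT

end WishartEnsemble

/-- **Lévy's continuity theorem** for convergence in distribution to a measure on `ℝ`, along a
countably generated filter. -/
lemma tendstoInDistribution_id_of_tendsto_charFun {ι : Type*} {l : Filter ι}
    [l.IsCountablyGenerated] {Ω : ι → Type*} {m : ∀ i, MeasurableSpace (Ω i)}
    {μ : (i : ι) → Measure (Ω i)} [∀ i, IsProbabilityMeasure (μ i)] {ν : Measure ℝ}
    [IsProbabilityMeasure ν] {X : (i : ι) → Ω i → ℝ} (hX : ∀ i, AEMeasurable (X i) (μ i))
    (h : ∀ t, Tendsto (fun i ↦ charFun ((μ i).map (X i)) t) l (𝓝 (charFun ν t))) :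
    TendstoInDistribution X l (id : ℝ → ℝ) μ ν where
  forall_aemeasurable := hX
  aemeasurable_limit := aemeasurable_id
  tendsto := by
    -- On a countably generated filter, convergence can be tested along sequences, where Lévy's
    -- theorem applies.
    refine tendsto_of_seq_tendsto fun u hu ↦ ?_
    refine ProbabilityMeasure.tendsto_of_tendsto_charFun fun t ↦ ?_
    change Tendsto ((fun i ↦ charFun ((μ i).map (X i)) t) ∘ u) atTop (𝓝 (charFun (ν.map id) t))
    rw [Measure.map_id]
    exact (h t).comp hu

end

theorem theorem3 (β : ℝ) (hβ : 0 < β) :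
    -- the eigenvalue density is normalizable
    ∃ _ : ∀ (n : Set.Ici (1 : ℕ)) (c : Set.Ici (1 : ℝ)),
        IsProbabilityMeasure (WishartEnsemble.eigenvalueLaw β n c),
      -- any size `n`, as `c → ∞`
      (∀ n : Set.Ici (1 : ℕ),
        TendstoInDistribution
          (fun c : Set.Ici (1 : ℝ) ↦ WishartEnsemble.normalizedTrace β n c)
          atTop (id : ℝ → ℝ)
          (fun c ↦ WishartEnsemble.eigenvalueLaw β n c) (gaussianReal 0 1) ∧
        TendstoInDistribution
          (fun c : Set.Ici (1 : ℝ) ↦ WishartEnsemble.normalizedLogDet β n c)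
          atTop (id : ℝ → ℝ)
          (fun c ↦ WishartEnsemble.eigenvalueLaw β n c) (gaussianReal 0 1)) ∧
      -- `c → ∞` while `n` varies with `c` (for instance `n → ∞`)
      (∀ (n : ℕ → Set.Ici (1 : ℕ)) (c : ℕ → Set.Ici (1 : ℝ)),
        Tendsto (fun k ↦ (c k : ℝ)) atTop atTop →
        TendstoInDistribution
          (fun k ↦ WishartEnsemble.normalizedTrace β (n k) (c k))
          atTop (id : ℝ → ℝ)
          (fun k ↦ WishartEnsemble.eigenvalueLaw β (n k) (c k)) (gaussianReal 0 1) ∧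
        (Tendsto (fun k ↦ ((n k : ℕ) : ℝ) ^ 2 / (c k : ℝ)) atTop (𝓝 0) →
          TendstoInDistribution
            (fun k ↦ WishartEnsemble.normalizedLogDet β (n k) (c k))
            atTop (id : ℝ → ℝ)
            (fun k ↦ WishartEnsemble.eigenvalueLaw β (n k) (c k)) (gaussianReal 0 1))) := by
  have hprob : ∀ (n : Set.Ici (1 : ℕ)) (c : Set.Ici (1 : ℝ)),
      IsProbabilityMeasure (WishartEnsemble.eigenvalueLaw β n c) := fun n c ↦
    WishartEnsemble.isProbabilityMeasure_eigenvalueLaw hβ n.2 c.2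
  have hcoe : Tendsto (fun c : Set.Ici (1 : ℝ) ↦ (c : ℝ)) atTop atTop :=
    tendsto_Ici_atTop.1 tendsto_id
  refine ⟨hprob, fun n ↦ ⟨?_, ?_⟩, fun n c hc ↦ ⟨?_, fun hnc ↦ ?_⟩⟩
  · exact tendstoInDistribution_id_of_tendsto_charFun
      (fun c ↦ (WishartEnsemble.measurable_normalizedTrace _ _ _).aemeasurable)
      (WishartEnsemble.tendsto_charFun_normalizedTrace hβ (fun _ ↦ n.2) (fun c ↦ c.2) hcoe)
  · exact tendstoInDistribution_id_of_tendsto_charFun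
      (fun c ↦ (WishartEnsemble.measurable_normalizedLogDet _ _ _).aemeasurable)
      (WishartEnsemble.tendsto_charFun_normalizedLogDet hβ (fun _ ↦ n.2) (fun c ↦ c.2) hcoe
        -- For fixed `n` the condition `n² / c → 0` is automatic.
        (tendsto_const_nhds.div_atTop hcoe))
  · exact tendstoInDistribution_id_of_tendsto_charFun
      (fun k ↦ (WishartEnsemble.measurable_normalizedTrace _ _ _).aemeasurable)
      (WishartEnsemble.tendsto_charFun_normalizedTrace hβ (fun k ↦ (n k).2) (fun k ↦ (c k).2) hc)
  · exact tendstoInDistribution_id_of_tendsto_charFun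
      (fun k ↦ (WishartEnsemble.measurable_normalizedLogDet _ _ _).aemeasurable)
      (WishartEnsemble.tendsto_charFun_normalizedLogDet hβ (fun k ↦ (n k).2) (fun k ↦ (c k).2) hc
        hnc)
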